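/- Let $f:\mathbb{R}^n\to\mathbb{R}$ be differentiable, $T\in\mathbb{R}^{m\times n}$ with $m\le n$, $b\in\mathbb{R}^m$, and consider the problem $$\min_{x\in\mathbb{R}^n} f(x)\quad\text{subject to } Tx=b. \tag{P}$$ Let $\|\cdot\|$ be the Euclidean norm and let $l,\mu,\alpha>0$. Assume: (1) $f$ is convex; (2) $(\nabla f(x)-\nabla f(y))^\top(x-y)\le l\|x-y\|^2$ for all $x,y\in\mathbb{R}^n$; (3) $T$ has full row rank $m$; (4) $T^\top=QR$ is a QR decomposition, with $Q\in\mathbb{R}^{n\times n}$ orthogonal and $R\in\mathbb{R}^{n\times m}$ upper triangular, and, if $m<n$, the function $g(x')=f(Qx')$ is $\mu$-partially strongly convex in the last $n-m$ coordinates (those which the constraint $TQx'=b$ leaves free), that is, with $S=\{m+1,\dots,n\}$ and $x'_S$ the restriction of $x'$ to $S$, $$(\nabla g(x')-\nabla g(y'))^\top(x'-y')\ge\mu\|x'_S-y'_S\|^2\quad\text{for all }x',y'\in\mathbb{R}^n;$$ (5) problem (P) has an optimal solution. Then the optimal solution $x^*$ of (P) is unique, and for the augmented primal-dual gradient flow $$\dot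 x=-\nabla f(x)-T^\top\lambda-\alpha T^\top(Tx-b),\qquad \dot\lambda=Tx-b,$$ the variable $x(t)$ converges globally and exponentially to $x^*$. Precisely: from every initial point $(x(0),\lambda(0))\in\mathbb{R}^n\times\mathbb{R}^m$ there is a trajectory defined for all $t\ge0$, and there are a multiplier $\lambda^*\in\mathbb{R}^m$ with $\nabla f(x^*)+T^\top\lambda^*=0$ and constants $c,\rho>0$ such that every trajectory satisfies $$\|x(t)-x^*\|\le c\,e^{-\rho t}\sqrt{\|x(0)-x^*\|^2+\|\lambda(0)-\lambda^*\|^2}\qquad\text{for all } t\ge0.$$ -/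

import Mathlib

noncomputable section

/-- The real `n`-dimensional Euclidean space (with the Euclidean norm). -/
abbrev Vec (n : ℕ) : Type := EuclideanSpace ℝ (Fin n)

/-- The action `v ↦ A v` of a real matrix on Euclidean vectors. -/
def mulV {m n : ℕ} (A : Matrix (Fin m) (Fin n) ℝ) (v : Vec n) : Vec m :=
  WithLp.toLp 2 (A.mulVec (WithLp.ofLp v))

/-- The partitioned vector `x_S`: the restriction of `x` to the index set `S`. -/
def partVec {n : ℕ} (S : Finset (Fin n)) (x : Vec n) : EuclideanSpace ℝ S :=
  WithLp.toLp 2 (fun i : S => x i)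

/-- Smoothness with constant `l`:
`(∇f(x) - ∇f(y))ᵀ (x - y) ≤ l ‖x - y‖²` for all `x`, `y`. -/
def SmoothWith {n : ℕ} (l : ℝ) (f : Vec n → ℝ) : Prop :=
  ∀ x y : Vec n, inner ℝ (gradient f x - gradient f y) (x - y) ≤ l * ‖x - y‖ ^ 2

/-- `μ`-partial strong convexity of a differentiable function with respect to `x_S`:
`(∇g(x) - ∇g(y))ᵀ (x - y) ≥ μ ‖x_S - y_S‖²` for all `x`, `y`. -/
def PartiallyStronglyConvex {n : ℕ} (μ : ℝ) (S : Finset (Fin n)) (g : Vec n → ℝ) : Prop :=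
  ∀ x y : Vec n,
    μ * ‖partVec S x - partVec S y‖ ^ 2 ≤ inner ℝ (gradient g x - gradient g y) (x - y)

/-- `A = Q R` is a (full) QR decomposition: `Q` is a square orthogonal matrix and
`R` is upper triangular, i.e. all its entries below the main diagonal vanish. -/
def IsQR {n m : ℕ} (A : Matrix (Fin n) (Fin m) ℝ) (Q : Matrix (Fin n) (Fin n) ℝ)
    (R : Matrix (Fin n) (Fin m) ℝ) : Prop :=
  Q ∈ Matrix.orthogonalGroup (Fin n) ℝ ∧
    (∀ (i : Fin n) (j : Fin m), (j : ℕ) < (i : ℕ) → R i j = 0) ∧ A = Q * R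

/-- The last `n - m` of the `n` coordinates (positions `m + 1, …, n`, counted from one). -/
def freeCoords (n m : ℕ) : Finset (Fin n) :=
  Finset.univ.filter (fun i => m ≤ (i : ℕ))

/-- `x` is an optimal solution of `min f(x)` subject to `T x = b`. -/
def IsOptimal {n m : ℕ} (f : Vec n → ℝ) (T : Matrix (Fin m) (Fin n) ℝ) (b : Vec m)
    (x : Vec n) : Prop :=
  mulV T x = b ∧ ∀ y : Vec n, mulV T y = b → f x ≤ f y

/-- `(x, lam)` is a trajectory on `[0, ∞)` of the augmented primal-dual gradient flow
`x' = -∇f(x) - Tᵀ lam - α Tᵀ (T x - b)`, `lam' = T x - b`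
(at time `0` the derivative is the one-sided one). -/
def IsTrajectory {n m : ℕ} (f : Vec n → ℝ) (T : Matrix (Fin m) (Fin n) ℝ) (b : Vec m) (α : ℝ)
    (x : ℝ → Vec n) (lam : ℝ → Vec m) : Prop :=
  ∀ t : ℝ, 0 ≤ t →
    HasDerivWithinAt x
      (-gradient f (x t) - mulV T.transpose (lam t)
        - α • mulV T.transpose (mulV T (x t) - b)) (Set.Ici 0) t ∧
    HasDerivWithinAt lam (mulV T (x t) - b) (Set.Ici 0) t

end

/-! Let e = x - x*, ν = λ - λ*, g = ∇f(x) - ∇f(x*). In ½‖e‖² + ½‖ν‖² the skew coupling through T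
cancels, which leaves the dissipation ⟨g, e⟩ + α‖Te‖². This dominates κ‖e‖²: partial strong
convexity controls the free coordinates of Qᵀe, and a vector of ker T whose free coordinates vanish
is zero (`eq_zero_of_mulV_eq_zero_of_partVec_eq_zero`, `exists_mul_norm_sq_le_add`). Nothing damps ν
yet. A small cross term δ⟨Te, ν⟩ adds -δ‖Tᵀν‖², which controls ν because Tᵀ is injective;
cocoercivity of ∇f (`norm_gradient_sub_sq_le`) lets ⟨g, e⟩ absorb the error in g
(`lyapunovDeriv_le`). Exponential decay follows. Cocoercivity and smoothness make ∇f Lipschitz,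
hence trajectories are global. -/

/-! ### Smooth convex functions: cocoercive and Lipschitz gradients. -/

section SmoothConvex

variable {E : Type*} [NormedAddCommGroup E] [InnerProductSpace ℝ E] [CompleteSpace E]

/-- The derivative of a function along a line, in terms of its gradient. -/
lemma hasDerivAt_comp_line {f : E → ℝ} (hf : Differentiable ℝ f) (x d : E) (t : ℝ) :
    HasDerivAt (fun s : ℝ => f (x + s • d)) (inner ℝ (gradient f (x + t • d)) d) t := by
  have h1 : HasDerivAt (fun s : ℝ => x + s • d) d t := by
    simpa using ((hasDerivAt_id t).smul_const d).const_add x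
  have h2 := (hf (x + t • d)).hasGradientAt.hasFDerivAt
  exact h2.comp_hasDerivAt t h1

/-- The quadratic upper bound of a smooth function. -/
lemma le_quadratic_of_smooth {f : E → ℝ} (hf : Differentiable ℝ f) {l : ℝ}
    (hl : ∀ x y : E, inner ℝ (gradient f x - gradient f y) (x - y) ≤ l * ‖x - y‖ ^ 2) (x d : E) :
    f (x + d) ≤ f x + inner ℝ (gradient f x) d + l / 2 * ‖d‖ ^ 2 := by
  set φ : ℝ → ℝ := fun t =>
    f (x + t • d) - t * inner ℝ (gradient f x) d - l / 2 * ‖d‖ ^ 2 * t ^ 2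
  have hφ (t : ℝ) : HasDerivAt φ (inner ℝ (gradient f (x + t • d)) d
      - inner ℝ (gradient f x) d - l * ‖d‖ ^ 2 * t) t := by
    have := ((hasDerivAt_comp_line hf x d t).sub
      ((hasDerivAt_id t).mul_const (inner ℝ (gradient f x) d))).sub
      ((hasDerivAt_pow 2 t).const_mul (l / 2 * ‖d‖ ^ 2))
    refine this.congr_deriv ?_
    norm_num
    ring
  have hanti : AntitoneOn φ (Set.Ici 0) := by
    refine antitoneOn_of_deriv_nonpos (convex_Ici 0)
      (fun t _ => (hφ t).continuousAt.continuousWithinAt)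
      (fun t _ => (hφ t).differentiableAt.differentiableWithinAt) fun t ht => ?_
    rw [interior_Ici, Set.mem_Ioi] at ht
    rw [(hφ t).deriv]
    have h := hl (x + t • d) x
    rw [add_sub_cancel_left, inner_smul_right, inner_sub_left, norm_smul, mul_pow,
      Real.norm_eq_abs, sq_abs] at h
    have : t * (inner ℝ (gradient f (x + t • d)) d - inner ℝ (gradient f x) d)
        ≤ t * (l * ‖d‖ ^ 2 * t) := by nlinarith
    linarith [le_of_mul_le_mul_left this ht]
  have := hanti (Set.mem_Ici.2 le_rfl) (Set.mem_Ici.2 zero_le_one) zero_le_one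
  simp only [φ, one_smul, zero_smul, add_zero] at this
  linarith

/-- The first-order lower bound of a differentiable convex function. -/
lemma ConvexOn.add_inner_gradient_le {f : E → ℝ} (hc : ConvexOn ℝ Set.univ f)
    (hf : Differentiable ℝ f) (x d : E) : f x + inner ℝ (gradient f x) d ≤ f (x + d) := by
  have hline : ConvexOn ℝ Set.univ (fun s : ℝ => f (x + s • d)) := by
    have := hc.comp_affineMap (AffineMap.lineMap x (x + d) : ℝ →ᵃ[ℝ] E)
    refine this.congr fun s _ => ?_
    simp [AffineMap.lineMap_apply, add_comm]
  have h := hline.le_slope_of_hasDerivAt (Set.mem_univ 0) (Set.mem_univ 1) zero_lt_one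
    (hasDerivAt_comp_line hf x d 0)
  rw [slope_def_field, one_smul, zero_smul, add_zero, sub_zero, div_one] at h
  linarith

/-- A smooth convex function has a cocoercive gradient. -/
lemma norm_gradient_sub_sq_le {f : E → ℝ} (hc : ConvexOn ℝ Set.univ f)
    (hf : Differentiable ℝ f) {l : ℝ} (hl0 : 0 < l)
    (hl : ∀ x y : E, inner ℝ (gradient f x - gradient f y) (x - y) ≤ l * ‖x - y‖ ^ 2) (x y : E) :
    ‖gradient f x - gradient f y‖ ^ 2 ≤ l * inner ℝ (gradient f x - gradient f y) (x - y) := by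
  have key (x y : E) : f x + inner ℝ (gradient f x) (y - x)
      + 1 / (2 * l) * ‖gradient f y - gradient f x‖ ^ 2 ≤ f y := by
    set g := gradient f y - gradient f x with hg
    -- The point y - g/l minimizes the quadratic upper bound at y minus the tangent at x; comparing
    -- the two there gives the sharpest inequality.
    have h1 := hc.add_inner_gradient_le hf x (y - x - (1 / l) • g)
    have h2 := le_quadratic_of_smooth hf hl y (-((1 / l) • g))
    rw [show x + (y - x - (1 / l) • g) = y + -((1 / l) • g) by abel] at h1
    rw [inner_sub_right, inner_smul_right] at h1
    rw [inner_neg_right, inner_smul_right, norm_neg, norm_smul, mul_pow, Real.norm_eq_abs,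
      sq_abs] at h2
    have h3 : inner ℝ (gradient f y) g - inner ℝ (gradient f x) g = ‖g‖ ^ 2 := by
      rw [← inner_sub_left, ← hg, real_inner_self_eq_norm_sq]
    have h4 : l / 2 * ((1 / l) ^ 2 * ‖g‖ ^ 2) = 1 / (2 * l) * ‖g‖ ^ 2 := by field_simp
    have h5 : 1 / l * ‖g‖ ^ 2 = 2 * (1 / (2 * l) * ‖g‖ ^ 2) := by field_simp
    have h6 : 1 / l * inner ℝ (gradient f y) g - 1 / l * inner ℝ (gradient f x) g
        = 1 / l * ‖g‖ ^ 2 := by rw [← h3]; ring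
    linarith
  have h1 := key x y
  have h2 := key y x
  rw [norm_sub_rev] at h1
  have h3 : inner ℝ (gradient f x) (y - x) = - inner ℝ (gradient f x) (x - y) := by
    rw [← inner_neg_right, neg_sub]
  have h4 : 2 * (1 / (2 * l) * ‖gradient f x - gradient f y‖ ^ 2)
      ≤ inner ℝ (gradient f x - gradient f y) (x - y) := by
    rw [inner_sub_left]; linarith
  calc ‖gradient f x - gradient f y‖ ^ 2
      = l * (2 * (1 / (2 * l) * ‖gradient f x - gradient f y‖ ^ 2)) := by field_simp
    _ ≤ _ := by gcongr

/-- The gradient of a smooth convex function is Lipschitz. -/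
lemma norm_gradient_sub_le {f : E → ℝ} (hc : ConvexOn ℝ Set.univ f)
    (hf : Differentiable ℝ f) {l : ℝ} (hl0 : 0 < l)
    (hl : ∀ x y : E, inner ℝ (gradient f x - gradient f y) (x - y) ≤ l * ‖x - y‖ ^ 2) (x y : E) :
    ‖gradient f x - gradient f y‖ ≤ l * ‖x - y‖ := by
  have h := norm_gradient_sub_sq_le hc hf hl0 hl x y
  refine le_of_sq_le_sq ?_ (by positivity)
  nlinarith [hl x y]

end SmoothConvex

/-! ### Global existence for Lipschitz autonomous equations. -/

section GlobalSolution

variable {E : Type*} [NormedAddCommGroup E] [NormedSpace ℝ E]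

/-- Solutions of an autonomous equation on consecutive intervals of length `ε` that fit together
form a solution on `[0, ∞)`. -/
lemma hasDerivWithinAt_Ici_of_steps {v : E → E} {γ : ℝ → E} {ε : ℝ} (hε : 0 < ε)
    (h : ∀ k : ℕ, ∀ t ∈ Set.Icc (k * ε) ((k + 1) * ε),
      HasDerivWithinAt γ (v (γ t)) (Set.Icc (k * ε) ((k + 1) * ε)) t) {t : ℝ} (ht : 0 ≤ t) :
    HasDerivWithinAt γ (v (γ t)) (Set.Ici 0) t := by
  obtain ⟨hk1, hk2⟩ : (⌊t / ε⌋₊ : ℝ) * ε ≤ t ∧ t < (⌊t / ε⌋₊ + 1) * ε :=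
    ⟨(le_div_iff₀ hε).1 (Nat.floor_le (by positivity)), (div_lt_iff₀ hε).1 (Nat.lt_floor_add_one _)⟩
  generalize ⌊t / ε⌋₊ = k at hk1 hk2
  have hk := h k t ⟨hk1, hk2.le⟩
  rcases hk1.lt_or_eq with hlt | heq
  · exact (hk.hasDerivAt (Icc_mem_nhds hlt hk2)).hasDerivWithinAt
  · rcases k with _ | k
    · have h0 : t = 0 := by simpa using heq.symm
      subst h0
      refine hk.mono_of_mem_nhdsWithin ?_
      have : Set.Icc (0 : ℝ) ε ∈ nhdsWithin 0 (Set.Ici 0) := Icc_mem_nhdsGE hε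
      simpa using this
    -- At a junction of two intervals, the one-sided derivatives agree, both being v (γ t).
    · have hk' := h k t ⟨by push_cast at heq; nlinarith, by push_cast at heq; exact heq.ge⟩
      have hu := hk'.union hk
      push_cast at hu heq hk2
      rw [Set.Icc_union_Icc_eq_Icc (by nlinarith) (by nlinarith)] at hu
      exact (hu.hasDerivAt (Icc_mem_nhds (by nlinarith) hk2)).hasDerivWithinAt

/-- If every point is the start of a solution on `[0, ε]`, with `ε` independent of the point, then
every point is the start of a solution on `[0, ∞)`. -/
lemma exists_hasDerivWithinAt_Ici_of_uniform {v : E → E} {ε : ℝ} (hε : 0 < ε)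
    (h : ∀ x : E, ∃ γ : ℝ → E, γ 0 = x ∧
      ∀ t ∈ Set.Icc 0 ε, HasDerivWithinAt γ (v (γ t)) (Set.Icc 0 ε) t) (x₀ : E) :
    ∃ γ : ℝ → E, γ 0 = x₀ ∧ ∀ t, 0 ≤ t → HasDerivWithinAt γ (v (γ t)) (Set.Ici 0) t := by
  choose φ hφ0 hφ using h
  set p : ℕ → E := fun k => (fun x => φ x ε)^[k] x₀ with hp
  have hps (k : ℕ) : p (k + 1) = φ (p k) ε := by
    simp only [hp, Function.iterate_succ_apply']
  set γ : ℝ → E := fun t => φ (p ⌊t / ε⌋₊) (t - ⌊t / ε⌋₊ * ε) with hγ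
  have hpiece (k : ℕ) : Set.EqOn γ (fun t => φ (p k) (t - k * ε))
      (Set.Icc (k * ε) ((k + 1) * ε)) := by
    rintro t ⟨h1, h2⟩
    rcases h2.lt_or_eq with hlt | heq
    · have : ⌊t / ε⌋₊ = k := by
        rw [Nat.floor_eq_iff (div_nonneg (le_trans (by positivity) h1) hε.le)]
        exact ⟨(le_div_iff₀ hε).2 h1, (div_lt_iff₀ hε).2 hlt⟩
      simp only [hγ, this]
    -- At the right endpoint the floor has already jumped; the pieces agree there because the next
    -- one starts where this one ends.
    · have : ⌊t / ε⌋₊ = k + 1 := by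
        rw [heq, mul_div_cancel_right₀ _ hε.ne']
        exact_mod_cast Nat.floor_natCast (R := ℝ) (k + 1)
      simp only [hγ, this]
      rw [heq]
      push_cast
      rw [sub_self, hφ0, hps]
      congr 1
      ring
  refine ⟨γ, by simp [hγ, hp, hφ0], fun t ht => hasDerivWithinAt_Ici_of_steps hε ?_ ht⟩
  intro k t hkt
  have hmem {s : ℝ} (hs : s ∈ Set.Icc (k * ε) ((k + 1) * ε)) : s - k * ε ∈ Set.Icc 0 ε :=
    ⟨by linarith [hs.1], by linarith [hs.2]⟩
  have h1 := (hφ (p k) _ (hmem hkt)).scomp t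
    ((hasDerivAt_id t).sub_const (k * ε)).hasDerivWithinAt (fun s hs => hmem hs)
  rw [one_smul] at h1
  rw [hpiece k hkt]
  exact h1.congr (hpiece k) (hpiece k hkt)

/-- A globally Lipschitz autonomous equation has a solution on `[0, ∞)` from every point. -/
lemma LipschitzWith.exists_hasDerivWithinAt_Ici [CompleteSpace E] {v : E → E} {K : NNReal}
    (hv : LipschitzWith K v) (x₀ : E) :
    ∃ γ : ℝ → E, γ 0 = x₀ ∧ ∀ t, 0 ≤ t → HasDerivWithinAt γ (v (γ t)) (Set.Ici 0) t := by
  -- On the ball of radius ‖v x‖ about x the speed is at most (1 + K)‖v x‖, so time 1 / (1 + K) is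
  -- safe whatever x is.
  have hε : (0 : ℝ) < 1 / (1 + K) := by positivity
  refine exists_hasDerivWithinAt_Ici_of_uniform hε (fun x => ?_) x₀
  have hpl : IsPicardLindelof (fun _ => v) (tmin := 0) (tmax := 1 / (1 + K))
      ⟨0, le_rfl, hε.le⟩ x ‖v x‖₊ 0 (‖v x‖₊ * (1 + K)) K := by
    refine IsPicardLindelof.of_time_independent (fun y hy => ?_) hv.lipschitzOnWith ?_
    · have h1 : ‖v y - v x‖ ≤ K * ‖y - x‖ := hv.norm_sub_le y x
      have h2 : ‖y - x‖ ≤ ‖v x‖ := by simpa [dist_eq_norm] using hy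
      have h3 : ‖v y‖ ≤ ‖v y - v x‖ + ‖v x‖ := by
        simpa using norm_add_le (v y - v x) (v x)
      have h4 : (K : ℝ) * ‖y - x‖ ≤ K * ‖v x‖ := by gcongr
      push_cast
      linarith
    · push_cast
      rw [sub_zero, sub_zero, max_eq_left hε.le, sub_zero]
      have : (1 + K : ℝ) ≠ 0 := by positivity
      exact le_of_eq (by field_simp)
  exact hpl.exists_eq_forall_mem_Icc_hasDerivWithinAt₀

end GlobalSolution

/-! ### Lyapunov analysis of the primal-dual flow. -/

section PrimalDualDecay

/-- A function on `[0, ∞)` with `V' ≤ -r V` decays exponentially. -/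
lemma le_exp_mul_of_hasDerivWithinAt_le {V V' : ℝ → ℝ} {r : ℝ}
    (hV : ∀ t, 0 ≤ t → HasDerivWithinAt V (V' t) (Set.Ici 0) t)
    (hle : ∀ t, 0 ≤ t → V' t ≤ -r * V t) {t : ℝ} (ht : 0 ≤ t) :
    V t ≤ Real.exp (-r * t) * V 0 := by
  have hW (t : ℝ) (ht : 0 ≤ t) : HasDerivWithinAt (fun s => Real.exp (r * s) * V s)
      (Real.exp (r * t) * (r * V t + V' t)) (Set.Ici 0) t := by
    have h1 : HasDerivAt (fun s : ℝ => Real.exp (r * s)) (Real.exp (r * t) * r) t := by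
      simpa using ((hasDerivAt_id t).const_mul r).exp
    exact (h1.hasDerivWithinAt.mul (hV t ht)).congr_deriv (by ring)
  have hanti : AntitoneOn (fun s => Real.exp (r * s) * V s) (Set.Ici 0) := by
    refine antitoneOn_of_hasDerivWithinAt_nonpos (convex_Ici 0)
      (fun t ht => (hW t ht).continuousWithinAt)
      (fun t ht => (hW t (interior_subset ht)).mono interior_subset) fun t ht => ?_
    have := hle t (interior_subset ht)
    exact mul_nonpos_of_nonneg_of_nonpos (Real.exp_pos _).le (by linarith)
  have h := hanti (Set.mem_Ici.2 le_rfl) (Set.mem_Ici.2 ht) ht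
  simp only [mul_zero, Real.exp_zero, one_mul] at h
  rw [neg_mul, Real.exp_neg, ← div_eq_inv_mul, le_div_iff₀' (Real.exp_pos _)]
  exact h

variable {E F : Type*} [NormedAddCommGroup E] [InnerProductSpace ℝ E]
  [NormedAddCommGroup F] [InnerProductSpace ℝ F]

/-- The Lyapunov function of the primal-dual flow, with a cross term of weight `δ`. -/
noncomputable def lyapunov (A : E →L[ℝ] F) (δ : ℝ) (e : E) (ν : F) : ℝ :=
  1 / 2 * ‖e‖ ^ 2 + 1 / 2 * ‖ν‖ ^ 2 + δ * inner ℝ (A e) ν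

/-- The derivative of `lyapunov` at `(e, ν)` in the direction `(e', ν')`. -/
noncomputable def lyapunovDeriv (A : E →L[ℝ] F) (δ : ℝ) (e e' : E) (ν ν' : F) : ℝ :=
  inner ℝ e e' + inner ℝ ν ν' + δ * (inner ℝ (A e) ν' + inner ℝ (A e') ν)

lemma hasDerivWithinAt_lyapunov (A : E →L[ℝ] F) (δ : ℝ) {e : ℝ → E} {ν : ℝ → F} {e' : E} {ν' : F}
    {s : Set ℝ} {t : ℝ} (he : HasDerivWithinAt e e' s t) (hν : HasDerivWithinAt ν ν' s t) :
    HasDerivWithinAt (fun t => lyapunov A δ (e t) (ν t)) (lyapunovDeriv A δ (e t) e' (ν t) ν')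
      s t := by
  have hA : HasDerivWithinAt (fun t => A (e t)) (A e') s t :=
    A.hasFDerivAt.comp_hasDerivWithinAt t he
  refine (((he.norm_sq.const_mul (1 / 2)).add (hν.norm_sq.const_mul (1 / 2))).add
    ((hA.inner ℝ hν).const_mul δ)).congr_deriv ?_
  rw [lyapunovDeriv]
  ring

lemma abs_inner_apply_le (A : E →L[ℝ] F) (e : E) (ν : F) :
    |inner ℝ (A e) ν| ≤ ‖A‖ / 2 * (‖e‖ ^ 2 + ‖ν‖ ^ 2) := by
  calc |inner ℝ (A e) ν| ≤ ‖A e‖ * ‖ν‖ := abs_real_inner_le_norm _ _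
    _ ≤ ‖A‖ * ‖e‖ * ‖ν‖ := by gcongr; exact A.le_opNorm e
    _ = ‖A‖ * (‖e‖ * ‖ν‖) := by ring
    _ ≤ ‖A‖ * ((‖e‖ ^ 2 + ‖ν‖ ^ 2) / 2) := by
        gcongr
        nlinarith [sq_nonneg (‖e‖ - ‖ν‖)]
    _ = _ := by ring

/-- The condition on δ keeps the cross term below a quarter of ‖e‖² + ‖ν‖², so `lyapunov` is
comparable to the squared distance. -/
lemma le_lyapunov {A : E →L[ℝ] F} {δ : ℝ} (hδ : 0 ≤ δ) (hA : δ * ‖A‖ ≤ 1 / 2) (e : E) (ν : F) :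
    1 / 4 * (‖e‖ ^ 2 + ‖ν‖ ^ 2) ≤ lyapunov A δ e ν := by
  have h1 := mul_le_mul_of_nonneg_left ((abs_le.1 (abs_inner_apply_le A e ν)).1) hδ
  have h2 := mul_le_mul_of_nonneg_right hA (show 0 ≤ ‖e‖ ^ 2 + ‖ν‖ ^ 2 by positivity)
  rw [lyapunov]
  linarith

lemma lyapunov_le {A : E →L[ℝ] F} {δ : ℝ} (hδ : 0 ≤ δ) (hA : δ * ‖A‖ ≤ 1 / 2) (e : E) (ν : F) :
    lyapunov A δ e ν ≤ ‖e‖ ^ 2 + ‖ν‖ ^ 2 := by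
  have h1 := mul_le_mul_of_nonneg_left ((abs_le.1 (abs_inner_apply_le A e ν)).2) hδ
  have h2 := mul_le_mul_of_nonneg_right hA (show 0 ≤ ‖e‖ ^ 2 + ‖ν‖ ^ 2 by positivity)
  have h3 : 0 ≤ ‖e‖ ^ 2 + ‖ν‖ ^ 2 := by positivity
  rw [lyapunov]
  linarith

/-- Dissipation of the Lyapunov function along the primal-dual flow. -/
lemma lyapunovDeriv_le {A : E →L[ℝ] F} {B : F →L[ℝ] E}
    (hAB : ∀ x y, inner ℝ (A x) y = inner ℝ x (B y)) {l α κ σ δ : ℝ} (hδ : 0 ≤ δ)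
    (hδl : δ * l ≤ 1 / 2) (hδα : δ * (α ^ 2 * ‖B‖ ^ 2 + 1) ≤ α / 2) {e g : E} {ν : F}
    (hcoc : ‖g‖ ^ 2 ≤ l * inner ℝ g e) (hg : 0 ≤ inner ℝ g e)
    (hκ : κ * ‖e‖ ^ 2 ≤ inner ℝ g e + α * ‖A e‖ ^ 2)
    (hσ : σ * ‖ν‖ ^ 2 ≤ ‖B ν‖ ^ 2) :
    lyapunovDeriv A δ e (-g - B ν - α • B (A e)) ν (A e)
      ≤ -(κ / 2 * ‖e‖ ^ 2 + δ * σ / 2 * ‖ν‖ ^ 2) := by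
  have h1 : lyapunovDeriv A δ e (-g - B ν - α • B (A e)) ν (A e)
      = -inner ℝ g e - α * ‖A e‖ ^ 2 + δ * (‖A e‖ ^ 2 - inner ℝ g (B ν) - ‖B ν‖ ^ 2
        - α * inner ℝ (B (A e)) (B ν)) := by
    rw [lyapunovDeriv, hAB (-g - B ν - α • B (A e)) ν]
    simp only [inner_sub_left, inner_sub_right, inner_neg_left, inner_neg_right,
      real_inner_smul_left, real_inner_smul_right, real_inner_self_eq_norm_sq, ← hAB e,
      real_inner_comm e g, real_inner_comm ν (A e)]
    ring
  -- Young's inequality here and in `h3` spends a quarter of ‖B ν‖² each, so half of it survives to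
  -- damp ν.
  have h2 : -inner ℝ g (B ν) ≤ ‖g‖ ^ 2 + ‖B ν‖ ^ 2 / 4 := by
    have := abs_le.1 (abs_real_inner_le_norm g (B ν))
    nlinarith [sq_nonneg (‖g‖ - ‖B ν‖ / 2)]
  have h3 : -(α * inner ℝ (B (A e)) (B ν)) ≤ α ^ 2 * ‖B‖ ^ 2 * ‖A e‖ ^ 2 + ‖B ν‖ ^ 2 / 4 := by
    have h4 : ‖α • B (A e)‖ ^ 2 ≤ α ^ 2 * ‖B‖ ^ 2 * ‖A e‖ ^ 2 := by
      rw [norm_smul, mul_pow, Real.norm_eq_abs, sq_abs, mul_assoc]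
      refine mul_le_mul_of_nonneg_left ?_ (sq_nonneg α)
      rw [← mul_pow]
      exact pow_le_pow_left₀ (norm_nonneg _) (B.le_opNorm _) 2
    have := abs_le.1 (abs_real_inner_le_norm (α • B (A e)) (B ν))
    rw [real_inner_smul_left] at this
    nlinarith [sq_nonneg (‖α • B (A e)‖ - ‖B ν‖ / 2)]
  have h5 : δ * (‖A e‖ ^ 2 - inner ℝ g (B ν) - ‖B ν‖ ^ 2 - α * inner ℝ (B (A e)) (B ν))
      ≤ δ * (l * inner ℝ g e + (α ^ 2 * ‖B‖ ^ 2 + 1) * ‖A e‖ ^ 2 - σ * ‖ν‖ ^ 2 / 2) :=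
    mul_le_mul_of_nonneg_left (by linarith) hδ
  -- The δ-errors cost at most half of ⟨g, e⟩ and half of α‖A e‖²; the other halves give κ/2.
  have h6 := mul_le_mul_of_nonneg_right hδl hg
  have h7 := mul_le_mul_of_nonneg_right hδα (sq_nonneg ‖A e‖)
  rw [h1]
  linarith

/-- Exponential decay of the primal variable of the augmented primal-dual flow, for a cocoercive
field `G` that becomes strongly monotone when the constraint is penalized. -/
lemma exists_exp_decay_primalDual {A : E →L[ℝ] F} {B : F →L[ℝ] E}
    (hAB : ∀ x y, inner ℝ (A x) y = inner ℝ x (B y)) {G : E → E} {l α κ σ : ℝ}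
    (hl : 0 < l) (hα : 0 < α) (hκ0 : 0 < κ) (hσ0 : 0 < σ)
    (hcoc : ∀ x y, ‖G x - G y‖ ^ 2 ≤ l * inner ℝ (G x - G y) (x - y))
    (hκ : ∀ x y, κ * ‖x - y‖ ^ 2 ≤ inner ℝ (G x - G y) (x - y) + α * ‖A (x - y)‖ ^ 2)
    (hσ : ∀ ν, σ * ‖ν‖ ^ 2 ≤ ‖B ν‖ ^ 2) {xs : E} {lams : F} (hs : G xs + B lams = 0) :
    ∃ c ρ : ℝ, 0 < c ∧ 0 < ρ ∧ ∀ (x : ℝ → E) (lam : ℝ → F),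
      (∀ t, 0 ≤ t → HasDerivWithinAt x
          (-G (x t) - B (lam t) - α • B (A (x t) - A xs)) (Set.Ici 0) t ∧
        HasDerivWithinAt lam (A (x t) - A xs) (Set.Ici 0) t) →
      ∀ t, 0 ≤ t → ‖x t - xs‖ ≤
        c * Real.exp (-ρ * t) * Real.sqrt (‖x 0 - xs‖ ^ 2 + ‖lam 0 - lams‖ ^ 2) := by
  obtain ⟨δ, hδ, hδl, hδα, hδA⟩ : ∃ δ : ℝ, 0 < δ ∧ δ * l ≤ 1 / 2 ∧
      δ * (α ^ 2 * ‖B‖ ^ 2 + 1) ≤ α / 2 ∧ δ * ‖A‖ ≤ 1 / 2 := by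
    -- One entry per smallness condition; ‖A‖ + 1 avoids dividing by zero when A = 0.
    refine ⟨min (1 / 2 / l) (min (α / 2 / (α ^ 2 * ‖B‖ ^ 2 + 1)) (1 / 2 / (‖A‖ + 1))),
      by positivity, ?_, ?_, ?_⟩
    · rw [← le_div_iff₀ hl]
      exact min_le_left _ _
    · rw [← le_div_iff₀ (by positivity)]
      exact (min_le_right _ _).trans (min_le_left _ _)
    · refine le_trans (mul_le_mul_of_nonneg_left (le_add_of_nonneg_right zero_le_one)
        (by positivity)) ((le_div_iff₀ (by positivity : 0 < ‖A‖ + 1)).1 ?_)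
      exact (min_le_right _ _).trans (min_le_right _ _)
  obtain ⟨r, hr, hrκ, hrσ⟩ : ∃ r : ℝ, 0 < r ∧ r ≤ κ / 2 ∧ r ≤ δ * σ / 2 :=
    ⟨min (κ / 2) (δ * σ / 2), by positivity, min_le_left _ _, min_le_right _ _⟩
  -- The Lyapunov bounds 1/4 and 1 give a factor 4 for squared norms; the square root turns it into
  -- 2 and halves the rate r.
  refine ⟨2, r / 2, two_pos, by positivity, fun x lam hx t ht => ?_⟩
  have hmono (x y : E) : 0 ≤ inner ℝ (G x - G y) (x - y) :=
    nonneg_of_mul_nonneg_right ((sq_nonneg _).trans (hcoc x y)) hl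
  have hderiv (t : ℝ) (ht : 0 ≤ t) := hasDerivWithinAt_lyapunov A δ
    ((hx t ht).1.sub_const xs) ((hx t ht).2.sub_const lams)
  have hdiss (t : ℝ) (ht : 0 ≤ t) :
      lyapunovDeriv A δ (x t - xs) (-G (x t) - B (lam t) - α • B (A (x t) - A xs))
        (lam t - lams) (A (x t) - A xs) ≤ -r * lyapunov A δ (x t - xs) (lam t - lams) := by
    have h1 := lyapunovDeriv_le hAB (ν := lam t - lams) hδ.le hδl hδα (hcoc (x t) xs)
      (hmono (x t) xs) (hκ (x t) xs) (hσ _)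
    have h2 : -(G (x t) - G xs) - B (lam t - lams) - α • B (A (x t - xs))
        = -G (x t) - B (lam t) - α • B (A (x t) - A xs) := by
      rw [map_sub B (lam t), eq_neg_of_add_eq_zero_left hs, map_sub A]
      abel
    rw [h2, map_sub A] at h1
    have h3 := mul_le_mul_of_nonneg_left (lyapunov_le hδ.le hδA (x t - xs) (lam t - lams)) hr.le
    have h4 := mul_le_mul_of_nonneg_right hrκ (sq_nonneg ‖x t - xs‖)
    have h5 := mul_le_mul_of_nonneg_right hrσ (sq_nonneg ‖lam t - lams‖)
    linarith
  have hV := le_exp_mul_of_hasDerivWithinAt_le hderiv hdiss ht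
  have hlow := le_lyapunov hδ.le hδA (x t - xs) (lam t - lams)
  have hup := mul_le_mul_of_nonneg_left (lyapunov_le hδ.le hδA (x 0 - xs) (lam 0 - lams))
    (Real.exp_pos (-r * t)).le
  refine le_of_sq_le_sq ?_ (by positivity)
  rw [mul_pow, mul_pow, Real.sq_sqrt (by positivity), ← Real.exp_nat_mul,
    show ((2 : ℕ) : ℝ) * (-(r / 2) * t) = -r * t by push_cast; ring]
  nlinarith [sq_nonneg ‖lam t - lams‖]

end PrimalDualDecay

/-! ### Matrices, full row rank and the QR decomposition. -/

section Constraint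

/-- The action of a real matrix on Euclidean vectors, as a continuous linear map. -/
noncomputable def mulVL {m n : ℕ} (A : Matrix (Fin m) (Fin n) ℝ) : Vec n →L[ℝ] Vec m :=
  LinearMap.toContinuousLinearMap
    { toFun := mulV A
      map_add' := fun x y => by simp [mulV, Matrix.mulVec_add]
      map_smul' := fun c x => by simp [mulV, Matrix.mulVec_smul] }

@[simp]
lemma mulVL_apply {m n : ℕ} (A : Matrix (Fin m) (Fin n) ℝ) (x : Vec n) : mulVL A x = mulV A x :=
  rfl

lemma mulV_mul {m n k : ℕ} (A : Matrix (Fin m) (Fin n) ℝ) (B : Matrix (Fin n) (Fin k) ℝ)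
    (x : Vec k) : mulV (A * B) x = mulV A (mulV B x) := by
  simp [mulV, Matrix.mulVec_mulVec]

lemma mulV_one {n : ℕ} (x : Vec n) : mulV 1 x = x := by
  simp [mulV]

lemma inner_mulV_left {m n : ℕ} (A : Matrix (Fin m) (Fin n) ℝ) (x : Vec n) (y : Vec m) :
    inner ℝ (mulV A x) y = inner ℝ x (mulV A.transpose y) := by
  simp only [mulV, EuclideanSpace.inner_eq_star_dotProduct, star_trivial,
    Matrix.mulVec_transpose]
  rw [Matrix.dotProduct_mulVec]

/-- A matrix with full row rank has an injective transpose. -/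
lemma mulV_transpose_injective_of_rank_eq {m n : ℕ} {T : Matrix (Fin m) (Fin n) ℝ}
    (hT : T.rank = m) : Function.Injective (mulV T.transpose) := by
  have h : Function.Injective T.transpose.mulVec := by
    have hfin := LinearMap.finrank_range_add_finrank_ker T.transpose.mulVecLin
    rw [← Matrix.rank, Matrix.rank_transpose, hT, Module.finrank_fin_fun] at hfin
    have hker : LinearMap.ker T.transpose.mulVecLin = ⊥ :=
      Submodule.finrank_eq_zero.1 (by omega)
    exact LinearMap.ker_eq_bot.1 hker
  intro x y hxy
  exact WithLp.ofLp_injective 2 (h (WithLp.toLp_injective 2 hxy))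

/-- If `Tᵀ = Q R` is a QR decomposition and `T` has full row rank, then a vector in the kernel
of `T` whose free coordinates (those of `Qᵀ x`) vanish is zero. -/
lemma eq_zero_of_mulV_eq_zero_of_partVec_eq_zero {m n : ℕ} {T : Matrix (Fin m) (Fin n) ℝ}
    {Q : Matrix (Fin n) (Fin n) ℝ} {R : Matrix (Fin n) (Fin m) ℝ}
    (hrank : T.rank = m) (hQR : IsQR T.transpose Q R) {e : Vec n} (hT : mulV T e = 0)
    (hS : partVec (freeCoords n m) (mulV Q.transpose e) = 0) : e = 0 := by
  obtain ⟨hQ, hR, hTQR⟩ := hQR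
  have hmn : m ≤ n := hrank ▸ T.rank_le_width
  have hinj := mulV_transpose_injective_of_rank_eq hrank
  have hlow (i : Fin n) (hi : m ≤ i) (ν : Vec m) : mulV R ν i = 0 := by
    simp only [mulV, Matrix.mulVec, dotProduct]
    exact Finset.sum_eq_zero fun j _ => by rw [hR i j (j.2.trans_le hi), zero_mul]
  have hQQ : Q * Q.transpose = 1 := (Matrix.mem_orthogonalGroup_iff _ _).1 hQ
  -- The top m × m block of R: injective because Tᵀ = QR is and the lower rows of R vanish, hence
  -- surjective. So Qᵀe, having no free part, lies in the range of R.
  let P : Vec m →ₗ[ℝ] (Fin m → ℝ) :=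
    { toFun := fun ν i => mulVL R ν (Fin.castLE hmn i)
      map_add' := fun x y => by ext i; simp only [map_add]; rfl
      map_smul' := fun c x => by ext i; simp only [map_smul]; rfl }
  have hP : Function.Injective P := by
    rw [injective_iff_map_eq_zero]
    intro ν hν
    have hRν : mulV R ν = 0 := by
      ext i
      by_cases hi : m ≤ i
      · exact hlow i hi ν
      · exact congrFun hν ⟨i, not_le.1 hi⟩
    apply hinj
    rw [hTQR, mulV_mul, hRν, ← mulVL_apply, ← mulVL_apply, map_zero, map_zero]
  obtain ⟨ν, hν⟩ := (LinearMap.injective_iff_surjective_of_finrank_eq_finrank (by simp)).1 hP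
    (fun i => mulV Q.transpose e (Fin.castLE hmn i))
  have hRν : mulV R ν = mulV Q.transpose e := by
    ext i
    by_cases hi : m ≤ i
    · rw [hlow i hi ν]
      exact (congrFun (congrArg WithLp.ofLp hS) ⟨i, by simpa [freeCoords] using hi⟩).symm
    · exact congrFun hν ⟨i, not_le.1 hi⟩
  have he : e = mulV T.transpose ν := by
    rw [hTQR, mulV_mul, hRν, ← mulV_mul, hQQ, mulV_one]
  -- Now e lies in both the range of Tᵀ and ker T, which are orthogonal.
  rw [← inner_self_eq_zero (𝕜 := ℝ)]
  nth_rewrite 2 [he]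
  rw [← inner_mulV_left, hT, inner_zero_left]

end Constraint

/-! ### Coercivity, multipliers and existence of the flow. -/

section Coercive

variable {E F : Type*} [NormedAddCommGroup E] [InnerProductSpace ℝ E] [FiniteDimensional ℝ E]
  [NormedAddCommGroup F] [InnerProductSpace ℝ F]

/-- An injective linear map on a finite-dimensional space is bounded below. -/
lemma exists_mul_norm_sq_le_of_injective {G : Type*} [NormedAddCommGroup G] [NormedSpace ℝ G]
    (L : E →L[ℝ] G) (hL : Function.Injective L) :
    ∃ σ : ℝ, 0 < σ ∧ ∀ x, σ * ‖x‖ ^ 2 ≤ ‖L x‖ ^ 2 := by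
  obtain ⟨K, hK0, hK⟩ := (L : E →ₗ[ℝ] G).exists_antilipschitzWith (LinearMap.ker_eq_bot.2 hL)
  have hK0' : (0 : ℝ) < K := hK0
  refine ⟨1 / (K : ℝ) ^ 2, by positivity, fun x => ?_⟩
  have h : ‖x‖ ≤ K * ‖L x‖ := by
    simpa using hK.le_mul_dist x 0
  rw [one_div, inv_mul_le_iff₀ (by positivity), ← mul_pow]
  exact pow_le_pow_left₀ (norm_nonneg _) h 2

/-- Two linear maps with trivial common kernel are jointly bounded below. -/
lemma exists_mul_norm_sq_le_add {G : Type*} [NormedAddCommGroup G] [NormedSpace ℝ G]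
    (L : E →L[ℝ] F) (M : E →L[ℝ] G) (h : ∀ x, L x = 0 → M x = 0 → x = 0) {a b : ℝ}
    (ha : 0 < a) (hb : 0 < b) :
    ∃ κ : ℝ, 0 < κ ∧ ∀ x, κ * ‖x‖ ^ 2 ≤ a * ‖L x‖ ^ 2 + b * ‖M x‖ ^ 2 := by
  obtain ⟨σ, hσ, hle⟩ := exists_mul_norm_sq_le_of_injective (L.prod M) (by
    rw [injective_iff_map_eq_zero]
    intro x hx
    exact h x (congrArg Prod.fst hx) (congrArg Prod.snd hx))
  refine ⟨min a b * σ, by positivity, fun x => ?_⟩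
  have h1 : ‖(L.prod M) x‖ ^ 2 ≤ ‖L x‖ ^ 2 + ‖M x‖ ^ 2 := by
    rw [ContinuousLinearMap.prod_apply, Prod.norm_def]
    rcases max_choice ‖L x‖ ‖M x‖ with hm | hm <;> rw [hm] <;>
      nlinarith [sq_nonneg ‖L x‖, sq_nonneg ‖M x‖]
  calc min a b * σ * ‖x‖ ^ 2 = min a b * (σ * ‖x‖ ^ 2) := by ring
    _ ≤ min a b * (‖L x‖ ^ 2 + ‖M x‖ ^ 2) := by
        gcongr
        exact (hle x).trans h1
    _ = min a b * ‖L x‖ ^ 2 + min a b * ‖M x‖ ^ 2 := by ring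
    _ ≤ _ := by
        gcongr
        · exact min_le_left _ _
        · exact min_le_right _ _

/-- Existence of a Lagrange multiplier for linear equality constraints. -/
lemma exists_multiplier [FiniteDimensional ℝ F] {f : E → ℝ} (hf : Differentiable ℝ f)
    {A : E →L[ℝ] F} {B : F →L[ℝ] E} (hAB : ∀ x y, inner ℝ (A x) y = inner ℝ x (B y)) {x : E}
    (hx : ∀ y, A y = A x → f x ≤ f y) : ∃ lam : F, gradient f x + B lam = 0 := by
  -- Moving along ker A stays feasible, so the gradient is orthogonal to ker A, that is, in the
  -- range of the adjoint B.
  have horth (d : E) (hd : A d = 0) : inner ℝ (gradient f x) d = 0 := by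
    have hmin : IsLocalMin (fun s : ℝ => f (x + s • d)) 0 :=
      Filter.Eventually.of_forall fun s => by
        simpa using hx (x + s • d) (by simp [hd])
    have := hmin.hasDerivAt_eq_zero (hasDerivAt_comp_line hf x d 0)
    rwa [zero_smul, add_zero] at this
  have hB : (B : F →ₗ[ℝ] E) = LinearMap.adjoint (A : E →ₗ[ℝ] F) := by
    rw [LinearMap.eq_adjoint_iff]
    intro y x
    rw [real_inner_comm]
    exact (hAB x y).symm.trans (real_inner_comm _ _)
  have hmem : gradient f x ∈ LinearMap.range (B : F →ₗ[ℝ] E) := by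
    rw [hB, ← LinearMap.orthogonal_ker, Submodule.mem_orthogonal]
    intro d hd
    rw [real_inner_comm]
    exact horth d hd
  obtain ⟨lam, hlam⟩ := hmem
  refine ⟨-lam, ?_⟩
  rw [map_neg, ← hlam]
  exact add_neg_cancel _

/-- The augmented primal-dual flow of a Lipschitz field exists for all times. -/
lemma exists_primalDual_flow [FiniteDimensional ℝ F] {G : E → E} {l : ℝ}
    (hG : ∀ x y, ‖G x - G y‖ ≤ l * ‖x - y‖) (A : E →L[ℝ] F) (B : F →L[ℝ] E) (α : ℝ) (b : F)
    (x₀ : E) (lam₀ : F) :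
    ∃ (x : ℝ → E) (lam : ℝ → F), x 0 = x₀ ∧ lam 0 = lam₀ ∧ ∀ t, 0 ≤ t →
      HasDerivWithinAt x (-G (x t) - B (lam t) - α • B (A (x t) - b)) (Set.Ici 0) t ∧
      HasDerivWithinAt lam (A (x t) - b) (Set.Ici 0) t := by
  have hGl : LipschitzWith l.toNNReal G := LipschitzWith.of_dist_le_mul fun x y => by
    rw [dist_eq_norm, dist_eq_norm]
    exact (hG x y).trans (by gcongr; exact Real.le_coe_toNNReal l)
  have hA : LipschitzWith (‖A‖₊ * 1 + 0) (fun z : E × F => A z.1 - b) :=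
    (A.lipschitz.comp LipschitzWith.prod_fst).sub (LipschitzWith.const b)
  have hx := (((hGl.comp LipschitzWith.prod_fst).neg).sub
    (B.lipschitz.comp (LipschitzWith.prod_snd (α := E) (β := F)))).sub
    ((lipschitzWith_smul α).comp (B.lipschitz.comp hA))
  obtain ⟨γ, h0, hγ⟩ := (hx.prodMk hA).exists_hasDerivWithinAt_Ici (x₀, lam₀)
  refine ⟨fun t => (γ t).1, fun t => (γ t).2, by simp [h0], by simp [h0], fun t ht => ⟨?_, ?_⟩⟩
  · exact (ContinuousLinearMap.fst ℝ E F).hasFDerivAt.comp_hasDerivWithinAt t (hγ t ht)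
  · exact (ContinuousLinearMap.snd ℝ E F).hasFDerivAt.comp_hasDerivWithinAt t (hγ t ht)

end Coercive

/-! ### Change of coordinates by Q, and the main theorem. -/

/-- Partial strong convexity after an orthogonal change of coordinates, in terms of the gradient
of the original function. -/
lemma PartiallyStronglyConvex.le_inner_gradient_sub {n : ℕ} {f : Vec n → ℝ}
    (hf : Differentiable ℝ f) {Q : Matrix (Fin n) (Fin n) ℝ}
    (hQ : Q ∈ Matrix.orthogonalGroup (Fin n) ℝ) {μ : ℝ} {S : Finset (Fin n)}
    (h : PartiallyStronglyConvex μ S (fun x' => f (mulV Q x'))) (x y : Vec n) :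
    μ * ‖partVec S (mulV Q.transpose (x - y))‖ ^ 2
      ≤ inner ℝ (gradient f x - gradient f y) (x - y) := by
  have hQQ (z : Vec n) : mulV Q (mulV Q.transpose z) = z := by
    rw [← mulV_mul, (Matrix.mem_orthogonalGroup_iff _ _).1 hQ, mulV_one]
  have hgrad (z d : Vec n) : inner ℝ (gradient (fun x' => f (mulV Q x')) (mulV Q.transpose z)) d
      = inner ℝ (gradient f z) (mulV Q d) := by
    have h1 : HasFDerivAt (fun x' => f (mulV Q x')) ((fderiv ℝ f z).comp (mulVL Q))
        (mulV Q.transpose z) := by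
      have h2 : HasFDerivAt f (fderiv ℝ f z) (mulVL Q (mulV Q.transpose z)) := by
        rw [mulVL_apply, hQQ]
        exact (hf z).hasFDerivAt
      exact h2.comp _ (mulVL Q).hasFDerivAt
    rw [inner_gradient_left, inner_gradient_left, h1.fderiv]
    rfl
  have hsub : mulV Q.transpose (x - y) = mulV Q.transpose x - mulV Q.transpose y :=
    map_sub (mulVL Q.transpose) x y
  have hxy := h (mulV Q.transpose x) (mulV Q.transpose y)
  rw [inner_sub_left, hgrad, hgrad, ← inner_sub_left, ← hsub, hQQ] at hxy
  rw [hsub]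
  exact hxy

/-- The free part of a vector in the coordinates given by `Q`, as a linear map. -/
noncomputable def freePart {n : ℕ} (S : Finset (Fin n)) (Q : Matrix (Fin n) (Fin n) ℝ) :
    Vec n →L[ℝ] EuclideanSpace ℝ S :=
  LinearMap.toContinuousLinearMap
    { toFun := fun x => partVec S (mulVL Q.transpose x)
      map_add' := fun x y => by rw [map_add]; rfl
      map_smul' := fun c x => by rw [map_smul]; rfl }

theorem theorem1 {n m : ℕ} (f : Vec n → ℝ) (T : Matrix (Fin m) (Fin n) ℝ) (b : Vec m)
    (Q : Matrix (Fin n) (Fin n) ℝ) (R : Matrix (Fin n) (Fin m) ℝ) (l μ α : ℝ)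
    (hl : 0 < l) (hμ : 0 < μ) (hα : 0 < α)
    (hdiff : Differentiable ℝ f)
    (hconv : ConvexOn ℝ Set.univ f)
    (hsmooth : SmoothWith l f)
    (hrank : T.rank = m)
    (hQR : IsQR T.transpose Q R)
    (hpsc : m < n → PartiallyStronglyConvex μ (freeCoords n m) (fun x' => f (mulV Q x')))
    (hsol : ∃ x, IsOptimal f T b x) :
    -- every initial condition is the start of a trajectory defined for all times `t ≥ 0`
    (∀ (x₀ : Vec n) (lam₀ : Vec m), ∃ (x : ℝ → Vec n) (lam : ℝ → Vec m),
      IsTrajectory f T b α x lam ∧ x 0 = x₀ ∧ lam 0 = lam₀) ∧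
    -- there is exactly one optimal solution `xs`; with a multiplier `lams` it is an equilibrium,
    -- and along every trajectory `x t` converges to `xs` at a uniform exponential rate
    ∃ (xs : Vec n) (lams : Vec m),
      IsOptimal f T b xs ∧ (∀ y, IsOptimal f T b y → y = xs) ∧
      gradient f xs + mulV T.transpose lams = 0 ∧
      ∃ c ρ : ℝ, 0 < c ∧ 0 < ρ ∧
        ∀ (x : ℝ → Vec n) (lam : ℝ → Vec m), IsTrajectory f T b α x lam →
          ∀ t : ℝ, 0 ≤ t →
            ‖x t - xs‖ ≤
              c * Real.exp (-ρ * t) * Real.sqrt (‖x 0 - xs‖ ^ 2 + ‖lam 0 - lams‖ ^ 2) := by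
  have hQ := hQR.1
  have hcoc := norm_gradient_sub_sq_le hconv hdiff hl hsmooth
  have hlip := norm_gradient_sub_le hconv hdiff hl hsmooth
  have hAB : ∀ x y, inner ℝ (mulVL T x) y = inner ℝ x (mulVL T.transpose y) := inner_mulV_left T
  have hpart (x y : Vec n) : μ * ‖freePart (freeCoords n m) Q (x - y)‖ ^ 2
      ≤ inner ℝ (gradient f x - gradient f y) (x - y) := by
    rcases lt_or_ge m n with hmn | hmn
    · exact (hpsc hmn).le_inner_gradient_sub hdiff hQ x y
    -- Without free coordinates the bound reduces to monotonicity of the gradient.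
    · have hempty : freePart (freeCoords n m) Q (x - y) = 0 := by
        ext ⟨i, hi⟩
        have hi' : m ≤ (i : ℕ) := by simpa [freeCoords] using hi
        exact absurd (i.2.trans_le hmn) (not_lt.2 hi')
      rw [hempty, norm_zero, zero_pow two_ne_zero, mul_zero]
      exact nonneg_of_mul_nonneg_right ((sq_nonneg _).trans (hcoc x y)) hl
  obtain ⟨κ, hκ0, hκ⟩ := exists_mul_norm_sq_le_add (freePart (freeCoords n m) Q) (mulVL T)
    (fun x hS hT => eq_zero_of_mulV_eq_zero_of_partVec_eq_zero hrank hQR hT hS) hμ hα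
  have hκ' (x y : Vec n) : κ * ‖x - y‖ ^ 2
      ≤ inner ℝ (gradient f x - gradient f y) (x - y) + α * ‖mulVL T (x - y)‖ ^ 2 :=
    (hκ (x - y)).trans (add_le_add_left (hpart x y) _)
  obtain ⟨σ, hσ0, hσ⟩ := exists_mul_norm_sq_le_of_injective (mulVL T.transpose)
    (mulV_transpose_injective_of_rank_eq hrank)
  refine ⟨fun x₀ lam₀ => ?_, ?_⟩
  · obtain ⟨x, lam, h0, h1, h⟩ :=
      exists_primalDual_flow hlip (mulVL T) (mulVL T.transpose) α b x₀ lam₀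
    exact ⟨x, lam, h, h0, h1⟩
  have hmult (z : Vec n) (hz : IsOptimal f T b z) :
      ∃ lam, gradient f z + mulVL T.transpose lam = 0 :=
    exists_multiplier hdiff hAB fun y hy => hz.2 y (hy.trans hz.1)
  obtain ⟨xs, hxs⟩ := hsol
  obtain ⟨lams, hlams⟩ := hmult xs hxs
  refine ⟨xs, lams, hxs, fun y hy => ?_, hlams, ?_⟩
  · obtain ⟨lamy, hlamy⟩ := hmult y hy
    have hT : mulVL T (y - xs) = 0 := by
      rw [map_sub, mulVL_apply, mulVL_apply, hy.1, hxs.1, sub_self]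
    have h := hκ' y xs
    -- The gradients of two optima differ by an element of the range of Tᵀ, orthogonal to y - xs in
    -- ker T; the right side of `h` is then zero.
    have hg : gradient f y - gradient f xs = mulVL T.transpose (lams - lamy) := by
      rw [eq_neg_of_add_eq_zero_left hlamy, eq_neg_of_add_eq_zero_left hlams, map_sub]
      abel
    rw [hg, real_inner_comm, ← hAB, hT, inner_zero_left, norm_zero, zero_pow two_ne_zero,
      mul_zero, add_zero] at h
    have h2 : ‖y - xs‖ ^ 2 ≤ 0 := nonpos_of_mul_nonpos_right h hκ0
    exact sub_eq_zero.1 (norm_eq_zero.1 (pow_eq_zero_iff two_ne_zero |>.1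
      (le_antisymm h2 (sq_nonneg _))))
  · obtain ⟨c, ρ, hc, hρ, h⟩ := exists_exp_decay_primalDual hAB hl hα hκ0 hσ0 hcoc hκ' hσ hlams
    refine ⟨c, ρ, hc, hρ, fun x lam hx => h x lam ?_⟩
    rw [mulVL_apply T xs, hxs.1]
    exact hx
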